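/- Let $q$ be a natural number, $n>0$ real, and $S,F$ real $q\times q$ matrices. For $\delta>0$ and a positive definite $p\times p$ matrix $D$, let $\mathrm{IW}_p(\delta,D)$ be the law on symmetric positive definite $p\times p$ matrices $\Sigma$ whose density with respect to Lebesgue measure on the $p(p+1)/2$ free entries is proportional to $|\Sigma|^{-(\delta+2p)/2}\exp\{-\tfrac12\mathrm{tr}(D\Sigma^{-1})\}$ (so its mean is $D/(\delta-2)$ when $\delta>2$). Put $M=\begin{pmatrix}S&SF'\\FS&S\end{pmatrix}$ and let $J$ be the joint law of the two diagonal blocks $(\Sigma_{t-1},\Sigma_t)$ of a random matrix $\begin{pmatrix}\Sigma_{t-1}&\phi_t'\\ \phi_t&\Sigma_t\end{pmatrix}\sim \mathrm{IW}_{2q}(n+2,nM)$. The IW-AR(1) process $(\Sigma_t)_{t=0,1,2,\dots}$ is the first-order Markov process whose initial law is the first margin of $J$ and whose transition kernel, the same at all times, is the conditional distribution under $J$ of the second component given the first. Then the scale matrix $nM$ is (symmetric) positive definite if and only if $S$ and $V=S-FSF'$ are positive definite. In that case $\mathrm{IW}_{2q}(n+2,nM)$ and $\mathrm{IW}_q(n+2,nS)$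 are well-defined probability laws, the IW-AR(1) process exists, it is strictly stationary, every consecutive pair $(\Sigma_t,\Sigma_{t+1})$ has law $J$, and $\Sigma_t\sim\mathrm{IW}_q(n+2,nS)$ for every $t\ge 0$. -/

import Mathlib

open MeasureTheory ProbabilityTheory
open scoped ENNReal Matrix

noncomputable section

namespace IWAR

/-- Real matrices carry the product (= Borel) sigma-algebra of their entries. -/
instance instMeasurableSpaceMatrix {m k : Type*} : MeasurableSpace (Matrix m k ℝ) :=
  inferInstanceAs (MeasurableSpace (m → k → ℝ))

/-- The symmetric matrix whose `(i, j)` and `(j, i)` entries are the coordinate of the unordered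
pair `s(i, j)`. The coordinates are the `p (p + 1) / 2` free entries of a symmetric matrix. -/
def symMat {ι : Type*} (x : Sym2 ι → ℝ) : Matrix ι ι ℝ :=
  Matrix.of fun i j => x s(i, j)

/-- Unnormalised inverse Wishart density with `δ` degrees of freedom and scale matrix `D`, for
`p × p` matrices `p = card ι`, in the parameterisation in which the mean is `D / (δ - 2)`:
`|Σ| ^ (-(δ + 2 p) / 2) * exp (-tr (D Σ⁻¹) / 2)` on positive definite `Σ`, and `0` elsewhere. -/
def invWishartKernel {ι : Type*} [Fintype ι] [DecidableEq ι] (δ : ℝ) (D : Matrix ι ι ℝ) :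
    Matrix ι ι ℝ → ℝ≥0∞ :=
  Set.indicator {Sig : Matrix ι ι ℝ | Sig.PosDef} fun Sig =>
    ENNReal.ofReal
      (Sig.det ^ (-(δ + 2 * (Fintype.card ι : ℝ)) / 2) * Real.exp (-(D * Sig⁻¹).trace / 2))

/-- The unnormalised inverse Wishart measure: the density above with respect to Lebesgue measure
on the free entries of a symmetric matrix. -/
def invWishartUnnorm {ι : Type*} [Fintype ι] [DecidableEq ι] (δ : ℝ) (D : Matrix ι ι ℝ) :
    Measure (Matrix ι ι ℝ) :=
  ((volume : Measure (Sym2 ι → ℝ)).withDensity fun x => invWishartKernel δ D (symMat x)).map symMat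

/-- The inverse Wishart law `IW_p(δ, D)`: the unnormalised measure divided by its total mass. -/
def invWishart {ι : Type*} [Fintype ι] [DecidableEq ι] (δ : ℝ) (D : Matrix ι ι ℝ) :
    Measure (Matrix ι ι ℝ) :=
  (invWishartUnnorm δ D Set.univ)⁻¹ • invWishartUnnorm δ D

/-- The `2q × 2q` matrix `[[S, S F'], [F S, S]]`. -/
def blockScale {q : ℕ} (S F : Matrix (Fin q) (Fin q) ℝ) :
    Matrix (Fin q ⊕ Fin q) (Fin q ⊕ Fin q) ℝ :=
  Matrix.fromBlocks S (S * Fᵀ) (F * S) S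

/-- The law of two consecutive matrices `(Σ_{t-1}, Σ_t)`: the joint law of the two diagonal blocks
of a random matrix `[[Σ_{t-1}, φ_t'], [φ_t, Σ_t]]` with law
`IW_{2q}(n + 2, n [[S, S F'], [F S, S]])`. -/
def consecutiveLaw {q : ℕ} (n : ℝ) (S F : Matrix (Fin q) (Fin q) ℝ) :
    Measure (Matrix (Fin q) (Fin q) ℝ × Matrix (Fin q) (Fin q) ℝ) :=
  (invWishart (n + 2) (n • blockScale S F)).map fun M => (M.toBlocks₁₁, M.toBlocks₂₂)

/-- `X` is, under `P`, the IW-AR(1) process with parameters `n, S, F`: the first-order Markov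
process on `t = 0, 1, 2, …` whose initial law is that of the first component of `consecutiveLaw`
and whose time-invariant transition kernel is a conditional distribution `κ` of the second
component of `consecutiveLaw` given the first. In terms of densities, this says
`p(Σ_0, …, Σ_T) = p(Σ_0, Σ_1) ∏_{t = 2}^T p(Σ_{t-1}, Σ_t) / p(Σ_{t-1})`. -/
def IsIWAR1 {q : ℕ} (n : ℝ) (S F : Matrix (Fin q) (Fin q) ℝ) {Ω : Type*} [MeasurableSpace Ω]
    (P : Measure Ω) (X : ℕ → Ω → Matrix (Fin q) (Fin q) ℝ) : Prop :=
  ∃ κ : Kernel (Matrix (Fin q) (Fin q) ℝ) (Matrix (Fin q) (Fin q) ℝ),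
    IsMarkovKernel κ ∧
    (consecutiveLaw n S F).fst ⊗ₘ κ = consecutiveLaw n S F ∧
    HasLaw (X 0) (consecutiveLaw n S F).fst P ∧
    ∀ t : ℕ, HasCondDistrib (X (t + 1)) (fun ω (i : Finset.Iic t) => X i ω)
      (κ.comap (fun x : Finset.Iic t → Matrix (Fin q) (Fin q) ℝ =>
        x ⟨t, Finset.mem_Iic.2 le_rfl⟩) (measurable_pi_apply _)) P

/-- Strict stationarity of a process in discrete time `t = 0, 1, 2, …`: all finite-dimensional
laws are invariant under time shifts. -/
def StrictlyStationary {Ω E : Type*} [MeasurableSpace Ω] [MeasurableSpace E]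
    (P : Measure Ω) (X : ℕ → Ω → E) : Prop :=
  ∀ (h m : ℕ) (t : Fin m → ℕ),
    P.map (fun ω i => X (t i + h) ω) = P.map (fun ω i => X (t i) ω)

end IWAR

end

/-! The first margin of $J$ composed with the transition kernel is $J$ itself, so the initial law is
invariant exactly when the two margins of $J$ agree. Invariance then gives strict stationarity by
induction on the length of a time window (`map_window_eq`). The margins do agree: both diagonal
blocks of $M$ equal $S$, and a diagonal block of an inverse Wishart matrix is inverse Wishart with
the same $\delta$ (`map_toBlocks₁₁_invWishart`; the other block follows by relabelling indices).

For the block marginal, write a matrix with blocks $A, B', B, C$ through $A$, $T = BA^{-1}$ and $L =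
C - BA^{-1}B'$. The density times the Jacobian is a kernel in $A$ times a kernel in $(T, L)$
(`invWishartKernel_regressionBlocks`), so integrating out $(T, L)$ leaves only a constant,
`residualMass`.

The same factorisation yields normalisability: splitting off one index at a time reduces the total
mass to factors with scalar $L$, which are bounded explicitly (`residualMass_unit_ne_top`). Validity
of the scale matrix is the Schur complement criterion, the complement of $S$ in $M$ being $V$.
Existence comes from disintegrating $J$ and building the trajectory measure of the resulting kernel.
-/

noncomputable section

namespace IWAR

/-! ### Schur complements and regression coordinates -/

section LinearAlgebra

variable {ι κ : Type*}

theorem posDef_toBlocks₁₁ {M : Matrix (ι ⊕ κ) (ι ⊕ κ) ℝ} (hM : M.PosDef) :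
    M.toBlocks₁₁.PosDef :=
  hM.submatrix Sum.inl_injective

theorem transpose_eq_of_posDef {A : Matrix ι ι ℝ} (hA : A.PosDef) : Aᵀ = A := by
  simpa using hA.1.eq

theorem trace_fromBlocks [Fintype ι] [Fintype κ] (A : Matrix ι ι ℝ) (B : Matrix ι κ ℝ)
    (C : Matrix κ ι ℝ) (D : Matrix κ κ ℝ) :
    (Matrix.fromBlocks A B C D).trace = A.trace + D.trace := by
  simp [Matrix.trace, Fintype.sum_sum_type]

variable [Fintype ι] [DecidableEq ι]

/-- The block matrix with upper left block `A`, regression matrix `T` and residual block `L`. -/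
def regressionBlocks (A : Matrix ι ι ℝ) (T : Matrix κ ι ℝ) (L : Matrix κ κ ℝ) :
    Matrix (ι ⊕ κ) (ι ⊕ κ) ℝ :=
  Matrix.fromBlocks A (T * A)ᵀ (T * A) (L + T * A * Tᵀ)

theorem regressionBlocks_schur {A : Matrix ι ι ℝ} (hA : A.PosDef) (T : Matrix κ ι ℝ)
    (L : Matrix κ κ ℝ) :
    L + T * A * Tᵀ - T * A * A⁻¹ * (T * A)ᵀ = L := by
  have hu : IsUnit A.det := hA.det_pos.ne'.isUnit
  rw [Matrix.mul_nonsing_inv_cancel_right _ _ hu, Matrix.transpose_mul,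
    transpose_eq_of_posDef hA, Matrix.mul_assoc, add_sub_cancel_right]

variable [Fintype κ] [DecidableEq κ]

/-- Schur complement criterion for positive definiteness of a real block matrix. -/
theorem posDef_fromBlocks_iff {A : Matrix ι ι ℝ} (B : Matrix κ ι ℝ) (C : Matrix κ κ ℝ)
    (hA : A.PosDef) :
    (Matrix.fromBlocks A Bᵀ B C).PosDef ↔ (C - B * A⁻¹ * Bᵀ).PosDef := by
  have : Invertible A := hA.isUnit.invertible
  have hs := Matrix.PosDef.fromBlocks₁₁ (A := A) Bᵀ C hA
  simp only [Matrix.conjTranspose_eq_transpose_of_trivial, Matrix.transpose_transpose] at hs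
  have hd := Matrix.det_fromBlocks₁₁ A Bᵀ B C
  rw [Matrix.invOf_eq_nonsing_inv] at hd
  constructor
  · intro h
    -- The semidefinite criterion is upgraded by the determinant: definite means semidefinite and
    -- nonsingular, and the block determinant is the product of those of $A$ and its Schur
    -- complement.
    refine (hs.1 h.posSemidef).posDef_iff_det_ne_zero.2 fun h0 => h.det_pos.ne' ?_
    rw [hd, h0, mul_zero]
  · intro h
    refine (hs.2 h.posSemidef).posDef_iff_det_ne_zero.2 ?_
    rw [hd]
    exact (mul_pos hA.det_pos h.det_pos).ne'

theorem posDef_regressionBlocks_iff {A : Matrix ι ι ℝ} (hA : A.PosDef) (T : Matrix κ ι ℝ)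
    (L : Matrix κ κ ℝ) : (regressionBlocks A T L).PosDef ↔ L.PosDef := by
  rw [regressionBlocks, posDef_fromBlocks_iff _ _ hA, regressionBlocks_schur hA]

theorem det_regressionBlocks {A : Matrix ι ι ℝ} (hA : A.PosDef) (T : Matrix κ ι ℝ)
    (L : Matrix κ κ ℝ) : (regressionBlocks A T L).det = A.det * L.det := by
  have : Invertible A := hA.isUnit.invertible
  rw [regressionBlocks, Matrix.det_fromBlocks₁₁, Matrix.invOf_eq_nonsing_inv,
    regressionBlocks_schur hA]

theorem inv_regressionBlocks {A : Matrix ι ι ℝ} (hA : A.PosDef) (T : Matrix κ ι ℝ)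
    {L : Matrix κ κ ℝ} (hL : L.PosDef) :
    (regressionBlocks A T L)⁻¹ =
      Matrix.fromBlocks (A⁻¹ + Tᵀ * L⁻¹ * T) (-(Tᵀ * L⁻¹)) (-(L⁻¹ * T)) L⁻¹ := by
  have hAu : IsUnit A.det := hA.det_pos.ne'.isUnit
  have hLu : IsUnit L.det := hL.det_pos.ne'.isUnit
  apply Matrix.inv_eq_right_inv
  rw [regressionBlocks, Matrix.fromBlocks_multiply, ← Matrix.fromBlocks_one,
    Matrix.transpose_mul, transpose_eq_of_posDef hA]
  congr 1
  · rw [Matrix.mul_add, Matrix.mul_nonsing_inv _ hAu]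
    simp only [Matrix.mul_neg, Matrix.mul_assoc]
    abel
  · simp only [Matrix.mul_neg, Matrix.mul_assoc]
    abel
  · rw [Matrix.mul_add, Matrix.mul_nonsing_inv_cancel_right _ _ hAu, Matrix.add_mul,
      Matrix.mul_neg, Matrix.mul_nonsing_inv_cancel_left _ _ hLu]
    simp only [Matrix.mul_neg, Matrix.mul_assoc]
    abel
  · rw [Matrix.add_mul, Matrix.mul_nonsing_inv _ hLu]
    simp only [Matrix.mul_neg, Matrix.mul_assoc]
    abel

/-- The scale matrix of the residual block `L` given the regression matrix `T`. -/
def residualScale (D : Matrix (ι ⊕ κ) (ι ⊕ κ) ℝ) (T : Matrix κ ι ℝ) : Matrix κ κ ℝ :=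
  (Matrix.fromCols T (-1) : Matrix κ (ι ⊕ κ) ℝ) * D *
    (Matrix.fromCols T (-1) : Matrix κ (ι ⊕ κ) ℝ)ᵀ

/-- The inverse equals $\mathrm{diag}(A^{-1}, 0) + (T, -1)' L^{-1} (T, -1)$; cyclicity of the trace
moves $(T, -1)'$ around and produces `residualScale`. -/
theorem trace_mul_inv_regressionBlocks (D : Matrix (ι ⊕ κ) (ι ⊕ κ) ℝ) {A : Matrix ι ι ℝ}
    (hA : A.PosDef) (T : Matrix κ ι ℝ) {L : Matrix κ κ ℝ} (hL : L.PosDef) :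
    (D * (regressionBlocks A T L)⁻¹).trace = (D.toBlocks₁₁ * A⁻¹).trace +
      (residualScale D T * L⁻¹).trace := by
  rw [residualScale, inv_regressionBlocks hA T hL]
  conv_lhs => rw [← Matrix.fromBlocks_toBlocks D]
  conv_rhs => enter [2]; rw [← Matrix.fromBlocks_toBlocks D]
  rw [Matrix.fromBlocks_multiply, Matrix.transpose_fromCols, Matrix.fromCols_mul_fromBlocks,
    Matrix.fromCols_mul_fromRows, trace_fromBlocks]
  simp only [Matrix.mul_add, Matrix.add_mul, Matrix.trace_add, Matrix.mul_neg, Matrix.neg_mul,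
    Matrix.trace_neg, Matrix.transpose_neg, Matrix.transpose_one, Matrix.mul_one,
    Matrix.one_mul, neg_neg, neg_add]
  have h1 : (T * D.toBlocks₁₁ * Tᵀ * L⁻¹).trace = (D.toBlocks₁₁ * (Tᵀ * L⁻¹ * T)).trace := by
    rw [Matrix.mul_assoc, Matrix.mul_assoc, Matrix.trace_mul_comm]
    simp only [Matrix.mul_assoc]
  have h2 : (T * D.toBlocks₁₂ * L⁻¹).trace = (D.toBlocks₁₂ * (L⁻¹ * T)).trace := by
    rw [Matrix.mul_assoc, Matrix.trace_mul_comm]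
    simp only [Matrix.mul_assoc]
  rw [h1, h2, Matrix.mul_assoc D.toBlocks₂₁]
  ring

end LinearAlgebra

/-! ### Measurability of matrix operations and of the density -/

section Measurability

variable {ι κ : Type*}

instance borelSpace_matrix [Finite ι] [Finite κ] : BorelSpace (Matrix ι κ ℝ) :=
  have := Fintype.ofFinite ι
  have := Fintype.ofFinite κ
  inferInstanceAs (BorelSpace (ι → κ → ℝ))

instance standardBorelSpace_matrix [Countable ι] [Countable κ] :
    StandardBorelSpace (Matrix ι κ ℝ) :=
  inferInstanceAs (StandardBorelSpace (ι → κ → ℝ))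

theorem measurable_matrix {α : Type*} [MeasurableSpace α] {f : α → Matrix ι κ ℝ}
    (hf : ∀ i j, Measurable fun a => f a i j) : Measurable f :=
  measurable_pi_lambda _ fun i => measurable_pi_lambda _ fun j => hf i j

theorem measurable_matrix_apply (i : ι) (j : κ) : Measurable fun M : Matrix ι κ ℝ => M i j :=
  (measurable_pi_apply j).comp (measurable_pi_apply i)

theorem measurable_symMat : Measurable (symMat : (Sym2 ι → ℝ) → Matrix ι ι ℝ) :=
  measurable_matrix fun _ _ => measurable_pi_apply _

variable [Fintype ι]

theorem isClosed_posSemidef : IsClosed {M : Matrix ι ι ℝ | M.PosSemidef} := by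
  simp only [Matrix.posSemidef_iff_dotProduct_mulVec, Set.ofPred_and, Set.ofPred_forall]
  refine IsClosed.inter ?_ (isClosed_iInter fun x => ?_)
  · exact isClosed_eq (by fun_prop) continuous_id
  · exact isClosed_le continuous_const (by fun_prop)

variable [DecidableEq ι]

/-- The positive definite cone is the closed semidefinite cone minus the closed set where the
determinant vanishes. -/
theorem measurableSet_posDef : MeasurableSet {M : Matrix ι ι ℝ | M.PosDef} := by
  have : {M : Matrix ι ι ℝ | M.PosDef} = {M | M.PosSemidef} ∩ {M | M.det = 0}ᶜ := by
    ext M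
    exact ⟨fun h => ⟨h.posSemidef, h.det_pos.ne'⟩, fun h => h.1.posDef_iff_det_ne_zero.2 h.2⟩
  rw [this]
  exact isClosed_posSemidef.measurableSet.inter
    (isClosed_eq (by fun_prop) continuous_const).measurableSet.compl

theorem measurable_matrix_inv : Measurable fun M : Matrix ι ι ℝ => M⁻¹ := by
  have hd : Measurable fun M : Matrix ι ι ℝ => M.det := Continuous.measurable (by fun_prop)
  refine measurable_matrix fun i j => ?_
  have ha : Measurable fun M : Matrix ι ι ℝ => M.adjugate i j :=
    Continuous.measurable ((continuous_id.matrix_adjugate).matrix_elem i j)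
  simp only [Matrix.inv_def, Matrix.smul_apply, smul_eq_mul, Ring.inverse_eq_inv']
  exact hd.inv.mul ha

theorem measurable_trace_mul_inv (D : Matrix ι ι ℝ) :
    Measurable fun M : Matrix ι ι ℝ => (D * M⁻¹).trace :=
  (Continuous.measurable (by fun_prop : Continuous fun M : Matrix ι ι ℝ => (D * M).trace)).comp
    measurable_matrix_inv

theorem measurable_invWishartKernel (δ : ℝ) (D : Matrix ι ι ℝ) :
    Measurable (invWishartKernel δ D) := by
  refine Measurable.indicator ?_ measurableSet_posDef
  have hd : Measurable fun M : Matrix ι ι ℝ => M.det := Continuous.measurable (by fun_prop)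
  exact ((hd.pow_const _).mul
    ((measurable_trace_mul_inv D).neg.div_const 2).exp).ennreal_ofReal

theorem lintegral_invWishartUnnorm (δ : ℝ) (D : Matrix ι ι ℝ) {f : Matrix ι ι ℝ → ℝ≥0∞}
    (hf : Measurable f) :
    ∫⁻ M, f M ∂invWishartUnnorm δ D =
      ∫⁻ x : Sym2 ι → ℝ, invWishartKernel δ D (symMat x) * f (symMat x) := by
  rw [invWishartUnnorm, lintegral_map hf measurable_symMat]
  exact lintegral_withDensity_eq_lintegral_mul _
    ((measurable_invWishartKernel δ D).comp measurable_symMat) (hf.comp measurable_symMat)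

end Measurability

/-! ### Free entries of a symmetric block matrix -/

section Coordinates

variable {ι κ : Type*}

/-- Unordered pairs in `ι ⊕ κ` lie inside `ι`, across the two summands, or inside `κ`. -/
def sym2SumFun : (Sym2 ι ⊕ κ × ι) ⊕ Sym2 κ → Sym2 (ι ⊕ κ) :=
  Sum.elim (Sum.elim (Sym2.map Sum.inl) fun p => s(Sum.inr p.1, Sum.inl p.2)) (Sym2.map Sum.inr)

theorem sym2SumFun_bijective : Function.Bijective (sym2SumFun (ι := ι) (κ := κ)) := by
  constructor
  · rintro ((a | ⟨k, i⟩) | a) ((b | ⟨k', i'⟩) | b) h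
    · simpa [sym2SumFun, (Sym2.map.injective Sum.inl_injective).eq_iff] using h
    · induction a with | _ x y => simp [sym2SumFun] at h
    · induction a with | _ x y => induction b with | _ x' y' => simp [sym2SumFun] at h
    · induction b with | _ x y => simp [sym2SumFun] at h
    · simpa [sym2SumFun] using h
    · induction b with | _ x y => simp [sym2SumFun] at h
    · induction a with | _ x y => induction b with | _ x' y' => simp [sym2SumFun] at h
    · induction a with | _ x y => simp [sym2SumFun] at h
    · simpa [sym2SumFun, (Sym2.map.injective Sum.inr_injective).eq_iff] using h
  · intro s
    induction s with
    | _ x y =>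
      rcases x with i | k <;> rcases y with j | l
      · exact ⟨Sum.inl (Sum.inl s(i, j)), rfl⟩
      · exact ⟨Sum.inl (Sum.inr (l, i)), Sym2.eq_swap⟩
      · exact ⟨Sum.inl (Sum.inr (k, j)), rfl⟩
      · exact ⟨Sum.inr s(k, l), rfl⟩

/-- The decomposition of the unordered pairs in `ι ⊕ κ`. -/
def sym2SumEquiv : (Sym2 ι ⊕ κ × ι) ⊕ Sym2 κ ≃ Sym2 (ι ⊕ κ) :=
  Equiv.ofBijective sym2SumFun sym2SumFun_bijective

/-- The matrix with the given family of entries. -/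
def rectMat (b : κ × ι → ℝ) : Matrix κ ι ℝ :=
  Matrix.of fun k i => b (k, i)

theorem measurable_rectMat : Measurable (rectMat : (κ × ι → ℝ) → Matrix κ ι ℝ) :=
  measurable_matrix fun _ _ => measurable_pi_apply _

/-- The free entries of a symmetric block matrix from those of its blocks. -/
def blockCoord (z : ((Sym2 ι → ℝ) × (κ × ι → ℝ)) × (Sym2 κ → ℝ)) : Sym2 (ι ⊕ κ) → ℝ :=
  fun s => Sum.elim (Sum.elim z.1.1 z.1.2) z.2 (sym2SumEquiv.symm s)

theorem symMat_blockCoord (a : Sym2 ι → ℝ) (b : κ × ι → ℝ) (c : Sym2 κ → ℝ) :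
    symMat (blockCoord ((a, b), c)) =
      Matrix.fromBlocks (symMat a) (rectMat b)ᵀ (rectMat b) (symMat c) := by
  have h : ∀ x, blockCoord ((a, b), c) (sym2SumFun x) = Sum.elim (Sum.elim a b) c x := fun x =>
    congrArg _ (sym2SumEquiv.symm_apply_apply x)
  ext (i | k) (j | l)
  · exact h (Sum.inl (Sum.inl s(i, j)))
  · exact (congrArg _ Sym2.eq_swap).trans (h (Sum.inl (Sum.inr (l, i))))
  · exact h (Sum.inl (Sum.inr (k, j)))
  · exact h (Sum.inr s(k, l))

theorem measurePreserving_comp_equiv {α β : Type*} [Fintype α] [Fintype β] (e : α ≃ β) :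
    MeasurePreserving (fun (f : α → ℝ) (b : β) => f (e.symm b)) volume volume := by
  convert volume_measurePreserving_piCongrLeft (fun _ : β => ℝ) e using 1
  ext f b
  obtain ⟨a, rfl⟩ := e.surjective b
  simp [MeasurableEquiv.piCongrLeft_apply_apply]

theorem measurePreserving_sumElim {α β : Type*} [Fintype α] [Fintype β] :
    MeasurePreserving (fun z : (α → ℝ) × (β → ℝ) => (Sum.elim z.1 z.2 : α ⊕ β → ℝ))
      volume volume := by
  convert volume_measurePreserving_sumPiEquivProdPi_symm (fun _ : α ⊕ β => ℝ) using 1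
  ext z (a | b) <;> rfl

theorem measurePreserving_blockCoord [Fintype ι] [Fintype κ] [DecidableEq ι] [DecidableEq κ] :
    MeasurePreserving (blockCoord (ι := ι) (κ := κ)) volume volume :=
  (measurePreserving_comp_equiv sym2SumEquiv).comp
    (measurePreserving_sumElim.comp
      (measurePreserving_sumElim.prod (MeasurePreserving.id volume)))

end Coordinates

/-! ### Factorisation of the density and the block marginal -/

section Marginal

variable {ι κ : Type*}

theorem measurable_fromBlocks {α : Type*} [MeasurableSpace α] {f : α → Matrix ι ι ℝ}
    {g : α → Matrix κ ι ℝ} {h : α → Matrix κ κ ℝ} (hf : Measurable f) (hg : Measurable g)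
    (hh : Measurable h) :
    Measurable fun x => Matrix.fromBlocks (f x) (g x)ᵀ (g x) (h x) := by
  refine measurable_matrix ?_
  rintro (i | k) (j | l)
  · exact (measurable_matrix_apply i j).comp hf
  · exact (measurable_matrix_apply l i).comp hg
  · exact (measurable_matrix_apply k j).comp hg
  · exact (measurable_matrix_apply k l).comp hh

theorem measurable_toBlocks₁₁ :
    Measurable fun M : Matrix (ι ⊕ κ) (ι ⊕ κ) ℝ => M.toBlocks₁₁ :=
  measurable_matrix fun _ _ => measurable_matrix_apply _ _

theorem exists_symMat_eq {N : Matrix κ κ ℝ} (hN : Nᵀ = N) : ∃ v, symMat v = N :=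
  ⟨Sym2.lift ⟨fun i j => N i j, fun i j => congrFun (congrFun hN j) i⟩, rfl⟩

/-- Translation invariance of Lebesgue measure on the free entries; it removes the shift $TAT'$ from
the lower right block. -/
theorem lintegral_symMat_add [Fintype κ] {N : Matrix κ κ ℝ} (hN : Nᵀ = N) (G : Matrix κ κ ℝ → ℝ≥0∞) :
    ∫⁻ c, G (symMat c + N) = ∫⁻ c, G (symMat c) := by
  obtain ⟨v, rfl⟩ := exists_symMat_eq hN
  exact lintegral_add_right_eq_self (fun c => G (symMat c)) v

variable [Fintype ι] [DecidableEq ι] [Fintype κ] [DecidableEq κ]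

theorem lintegral_symMat_sum {G : Matrix (ι ⊕ κ) (ι ⊕ κ) ℝ → ℝ≥0∞} (hG : Measurable G) :
    ∫⁻ x, G (symMat x) = ∫⁻ a, ∫⁻ b, ∫⁻ c : Sym2 κ → ℝ,
      G (Matrix.fromBlocks (symMat a) (rectMat b)ᵀ (rectMat b) (symMat c)) := by
  have hm : Measurable fun z : ((Sym2 ι → ℝ) × (κ × ι → ℝ)) × (Sym2 κ → ℝ) =>
      G (symMat (blockCoord z)) :=
    hG.comp (measurable_symMat.comp measurePreserving_blockCoord.measurable)
  have hp := (measurePreserving_blockCoord (ι := ι) (κ := κ)).lintegral_comp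
    (hG.comp measurable_symMat)
  simp only [Function.comp_apply] at hp
  rw [← hp, Measure.volume_eq_prod, lintegral_prod _ hm.aemeasurable, Measure.volume_eq_prod,
    lintegral_prod _ hm.lintegral_prod_right'.aemeasurable]
  simp only [symMat_blockCoord]

open scoped Kronecker in
theorem rectMat_toLin'_one_kronecker (A : Matrix ι ι ℝ) (b : κ × ι → ℝ) :
    rectMat (Matrix.toLin' ((1 : Matrix κ κ ℝ) ⊗ₖ Aᵀ) b) = rectMat b * A := by
  ext k i
  simp [rectMat, Matrix.toLin'_apply, Matrix.mulVec, dotProduct, Fintype.sum_prod_type,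
    Matrix.kroneckerMap_apply, Matrix.one_apply, Matrix.mul_apply, mul_comm]

-- Right multiplication by $A$ acts on each row separately, as the matrix $1 \otimes A'$ on the
-- entries, which accounts for the power of $\det A$ in the Jacobian.
open scoped Kronecker in
theorem lintegral_rectMat_mul {A : Matrix ι ι ℝ} (hA : 0 < A.det) {H : Matrix κ ι ℝ → ℝ≥0∞}
    (hH : Measurable H) :
    ∫⁻ b : κ × ι → ℝ, H (rectMat b) =
      ENNReal.ofReal (A.det ^ Fintype.card κ) * ∫⁻ b : κ × ι → ℝ, H (rectMat b * A) := by
  have hdet : ((1 : Matrix κ κ ℝ) ⊗ₖ Aᵀ).det = A.det ^ Fintype.card κ := by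
    simp [Matrix.det_kronecker]
  have hpos : 0 < A.det ^ Fintype.card κ := pow_pos hA _
  have hmap := Real.map_matrix_volume_pi_eq_smul_volume_pi
    (M := (1 : Matrix κ κ ℝ) ⊗ₖ Aᵀ) (by rw [hdet]; exact hpos.ne')
  have hmeas : Measurable (Matrix.toLin' ((1 : Matrix κ κ ℝ) ⊗ₖ Aᵀ)) :=
    (LinearMap.continuous_of_finiteDimensional _).measurable
  have := lintegral_map (μ := volume) (hH.comp measurable_rectMat) hmeas
  simp only [Function.comp_apply, rectMat_toLin'_one_kronecker] at this
  rw [← this, hmap, lintegral_smul_measure, smul_eq_mul, ← mul_assoc, hdet,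
    ← ENNReal.ofReal_mul hpos.le, abs_of_pos (inv_pos.2 hpos), mul_inv_cancel₀ hpos.ne',
    ENNReal.ofReal_one, one_mul]

/-- The joint mass of regression matrix and residual block, which are independent of the upper
left block of an inverse Wishart matrix. -/
def residualMass (δ : ℝ) (D : Matrix (ι ⊕ κ) (ι ⊕ κ) ℝ) : ℝ≥0∞ :=
  ∫⁻ b : κ × ι → ℝ, ∫⁻ c : Sym2 κ → ℝ,
    invWishartKernel (δ + 2 * Fintype.card ι) (residualScale D (rectMat b)) (symMat c)

theorem invWishartKernel_regressionBlocks (δ : ℝ) (D : Matrix (ι ⊕ κ) (ι ⊕ κ) ℝ)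
    {A : Matrix ι ι ℝ} (hA : A.PosDef) (T : Matrix κ ι ℝ) (L : Matrix κ κ ℝ) :
    ENNReal.ofReal (A.det ^ Fintype.card κ) * invWishartKernel δ D (regressionBlocks A T L) =
      invWishartKernel δ D.toBlocks₁₁ A *
        invWishartKernel (δ + 2 * Fintype.card ι) (residualScale D T) L := by
  by_cases hL : L.PosDef
  · have hR := (posDef_regressionBlocks_iff hA T L).2 hL
    have hAd := hA.det_pos
    have hLd := hL.det_pos
    simp only [invWishartKernel]
    rw [Set.indicator_of_mem (by exact hR), Set.indicator_of_mem (by exact hA),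
      Set.indicator_of_mem (by exact hL), ← ENNReal.ofReal_mul (by positivity),
      ← ENNReal.ofReal_mul (by positivity), det_regressionBlocks hA,
      trace_mul_inv_regressionBlocks D hA T hL, Real.mul_rpow hAd.le hLd.le, Fintype.card_sum,
      neg_add (D.toBlocks₁₁ * A⁻¹).trace,
      add_div (-(D.toBlocks₁₁ * A⁻¹).trace), Real.exp_add]
    -- The Jacobian absorbs exactly the excess dimension in the exponent of $\det A$, so $\delta$ is
    -- unchanged for $A$. The exponent of $\det L$ stays as it is, which in the smaller dimension
    -- reads as $\delta + 2\,\mathrm{card}\,\iota$ degrees of freedom.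
    have h1 : A.det ^ Fintype.card κ *
        A.det ^ (-(δ + 2 * ((Fintype.card ι + Fintype.card κ : ℕ) : ℝ)) / 2) =
        A.det ^ (-(δ + 2 * (Fintype.card ι : ℝ)) / 2) := by
      rw [← Real.rpow_natCast, ← Real.rpow_add hAd]
      congr 1
      push_cast
      ring
    rw [← h1]
    push_cast
    ring_nf
  · have hR := mt (posDef_regressionBlocks_iff hA T L).1 hL
    simp only [invWishartKernel]
    rw [Set.indicator_of_notMem (a := regressionBlocks A T L) (by exact hR),
      Set.indicator_of_notMem (a := L) (by exact hL), mul_zero, mul_zero]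

theorem lintegral_invWishartKernel_fiber (δ : ℝ) (D : Matrix (ι ⊕ κ) (ι ⊕ κ) ℝ)
    (A : Matrix ι ι ℝ) :
    ∫⁻ b, ∫⁻ c, invWishartKernel δ D
        (Matrix.fromBlocks A (rectMat b)ᵀ (rectMat b) (symMat c)) =
      invWishartKernel δ D.toBlocks₁₁ A * residualMass δ D := by
  by_cases hA : A.PosDef
  · have hH : Measurable fun B : Matrix κ ι ℝ => ∫⁻ c : Sym2 κ → ℝ,
        invWishartKernel δ D (Matrix.fromBlocks A Bᵀ B (symMat c)) := by
      refine Measurable.lintegral_prod_right' (f := fun z : Matrix κ ι ℝ × (Sym2 κ → ℝ) =>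
        invWishartKernel δ D (Matrix.fromBlocks A z.1ᵀ z.1 (symMat z.2))) ?_
      exact (measurable_invWishartKernel δ D).comp (measurable_fromBlocks measurable_const
        measurable_fst (measurable_symMat.comp measurable_snd))
    have htr : ∀ T : Matrix κ ι ℝ, (T * A * Tᵀ)ᵀ = T * A * Tᵀ := fun T => by
      simp [Matrix.transpose_mul, transpose_eq_of_posDef hA, Matrix.mul_assoc]
    have hfin : invWishartKernel δ D.toBlocks₁₁ A ≠ ∞ := by
      rw [invWishartKernel, Set.indicator_of_mem (by exact hA)]
      exact ENNReal.ofReal_ne_top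
    -- Change of variables $B = TA$ at fixed $A$; the shift $C = L + TAT'$ at fixed $T$ follows
    -- inside the integral.
    rw [lintegral_rectMat_mul hA.det_pos hH, ← lintegral_const_mul' _ _ ENNReal.ofReal_ne_top,
      residualMass, ← lintegral_const_mul' _ _ hfin]
    refine lintegral_congr fun b => ?_
    rw [← lintegral_symMat_add (htr (rectMat b)) fun L => invWishartKernel δ D
        (Matrix.fromBlocks A (rectMat b * A)ᵀ (rectMat b * A) L),
      ← lintegral_const_mul' _ _ ENNReal.ofReal_ne_top, ← lintegral_const_mul' _ _ hfin]
    exact lintegral_congr fun c => invWishartKernel_regressionBlocks δ D hA _ _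
  · have h0 : ∀ b : κ × ι → ℝ, ∀ c : Sym2 κ → ℝ, invWishartKernel δ D
        (Matrix.fromBlocks A (rectMat b)ᵀ (rectMat b) (symMat c)) = 0 := fun b c =>
      Set.indicator_of_notMem (fun h => hA (Matrix.toBlocks_fromBlocks₁₁ A (rectMat b)ᵀ
        (rectMat b) (symMat c) ▸ posDef_toBlocks₁₁ (by exact h))) _
    simp only [h0, lintegral_zero]
    rw [invWishartKernel, Set.indicator_of_notMem (by exact hA), zero_mul]

theorem lintegral_lintegral_mul_const {α β : Type*} [MeasureSpace α] [MeasureSpace β]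
    [SFinite (volume : Measure β)] {F : α × β → ℝ≥0∞} (hF : Measurable F) (r : ℝ≥0∞) :
    ∫⁻ x, ∫⁻ y, F (x, y) * r = (∫⁻ x, ∫⁻ y, F (x, y)) * r := by
  rw [← lintegral_mul_const _ hF.lintegral_prod_right']
  exact lintegral_congr fun x => lintegral_mul_const _ (hF.comp measurable_prodMk_left)

theorem measurable_invWishartKernel_fiber (δ : ℝ) (D : Matrix (ι ⊕ κ) (ι ⊕ κ) ℝ)
    (A : Matrix ι ι ℝ) :
    Measurable fun z : (κ × ι → ℝ) × (Sym2 κ → ℝ) => invWishartKernel δ D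
      (Matrix.fromBlocks A (rectMat z.1)ᵀ (rectMat z.1) (symMat z.2)) :=
  (measurable_invWishartKernel δ D).comp (measurable_fromBlocks measurable_const
    (measurable_rectMat.comp measurable_fst) (measurable_symMat.comp measurable_snd))

/-- The upper left block of an unnormalised inverse Wishart measure is, up to a constant, again
inverse Wishart. -/
theorem map_toBlocks₁₁_invWishartUnnorm (δ : ℝ) (D : Matrix (ι ⊕ κ) (ι ⊕ κ) ℝ) :
    (invWishartUnnorm δ D).map (fun M => M.toBlocks₁₁) =
      residualMass δ D • invWishartUnnorm δ D.toBlocks₁₁ := by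
  refine Measure.ext_of_lintegral _ fun f hf => ?_
  have hf' : Measurable fun M : Matrix (ι ⊕ κ) (ι ⊕ κ) ℝ => f M.toBlocks₁₁ :=
    hf.comp measurable_toBlocks₁₁
  have hk := measurable_invWishartKernel δ D
  have hk' := measurable_invWishartKernel δ D.toBlocks₁₁
  have hkf : Measurable fun a : Sym2 ι → ℝ =>
      invWishartKernel δ D.toBlocks₁₁ (symMat a) * f (symMat a) :=
    (hk'.comp measurable_symMat).mul (hf.comp measurable_symMat)
  rw [lintegral_map hf measurable_toBlocks₁₁, lintegral_invWishartUnnorm δ D hf',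
    lintegral_smul_measure, lintegral_invWishartUnnorm δ _ hf,
    lintegral_symMat_sum (G := fun M => invWishartKernel δ D M * f M.toBlocks₁₁) (hk.mul hf'),
    smul_eq_mul, ← lintegral_const_mul _ hkf]
  refine lintegral_congr fun a => ?_
  simp only [Matrix.toBlocks_fromBlocks₁₁]
  rw [lintegral_lintegral_mul_const (measurable_invWishartKernel_fiber δ D (symMat a)),
    lintegral_invWishartKernel_fiber, mul_assoc, mul_left_comm]

end Marginal

/-! ### Invariance under relabelling, and the empty matrix -/

section Reindex

variable {ι κ : Type*}

theorem posDef_submatrix_equiv_iff (e : ι ≃ κ) (M : Matrix κ κ ℝ) :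
    (M.submatrix e e).PosDef ↔ M.PosDef := by
  refine ⟨fun h => ?_, fun h => h.submatrix e.injective⟩
  simpa using h.submatrix e.symm.injective

/-- An equivalence of types induces one of their unordered pairs. -/
def sym2Congr (e : ι ≃ κ) : Sym2 ι ≃ Sym2 κ where
  toFun := Sym2.map e
  invFun := Sym2.map e.symm
  left_inv s := by simp [Sym2.map_map]
  right_inv s := by simp [Sym2.map_map]

theorem measurable_submatrix (e : ι ≃ κ) :
    Measurable fun M : Matrix κ κ ℝ => M.submatrix e e :=
  measurable_matrix fun _ _ => measurable_matrix_apply _ _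

variable [Fintype ι] [DecidableEq ι] [Fintype κ] [DecidableEq κ]

theorem invWishartKernel_submatrix (e : ι ≃ κ) (δ : ℝ) (D M : Matrix κ κ ℝ) :
    invWishartKernel δ (D.submatrix e e) (M.submatrix e e) = invWishartKernel δ D M := by
  have htr : (D.submatrix e e * (M.submatrix e e)⁻¹).trace = (D * M⁻¹).trace := by
    rw [Matrix.inv_submatrix_equiv, Matrix.submatrix_mul_equiv]
    exact e.sum_comp fun i => (D * M⁻¹) i i
  by_cases hM : M.PosDef
  · have hM' := (posDef_submatrix_equiv_iff e M).2 hM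
    rw [invWishartKernel, invWishartKernel, Set.indicator_of_mem (a := M) (by exact hM),
      Set.indicator_of_mem (a := M.submatrix e e) (by exact hM'), htr,
      Matrix.det_submatrix_equiv_self, Fintype.card_congr e]
  · have hM' := mt (posDef_submatrix_equiv_iff e M).1 hM
    rw [invWishartKernel, invWishartKernel, Set.indicator_of_notMem (a := M) (by exact hM),
      Set.indicator_of_notMem (a := M.submatrix e e) (by exact hM')]

theorem map_submatrix_invWishartUnnorm (e : ι ≃ κ) (δ : ℝ) (D : Matrix κ κ ℝ) :
    (invWishartUnnorm δ D).map (fun M => M.submatrix e e) =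
      invWishartUnnorm δ (D.submatrix e e) := by
  refine Measure.ext_of_lintegral _ fun f hf => ?_
  have hk := (measurable_invWishartKernel δ (D.submatrix e e)).mul hf
  have hp := (measurePreserving_comp_equiv (sym2Congr e.symm)).lintegral_comp
    (hk.comp measurable_symMat)
  have hf' : Measurable fun M : Matrix κ κ ℝ => f (M.submatrix e e) :=
    hf.comp (measurable_submatrix e)
  rw [lintegral_map hf (measurable_submatrix e), lintegral_invWishartUnnorm _ _ hf',
    lintegral_invWishartUnnorm _ _ hf]
  refine Eq.trans (lintegral_congr fun x => ?_) hp
  have hx : symMat (fun b => x ((sym2Congr e.symm).symm b)) = (symMat x).submatrix e e := rfl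
  simp only [Function.comp_apply, Pi.mul_apply, hx, invWishartKernel_submatrix]

theorem invWishartUnnorm_submatrix_univ (e : ι ≃ κ) (δ : ℝ) (D : Matrix κ κ ℝ) :
    invWishartUnnorm δ (D.submatrix e e) Set.univ = invWishartUnnorm δ D Set.univ := by
  rw [← map_submatrix_invWishartUnnorm, Measure.map_apply (measurable_submatrix e) .univ,
    Set.preimage_univ]

theorem invWishartUnnorm_univ_of_isEmpty [IsEmpty ι] (δ : ℝ) (D : Matrix ι ι ℝ) :
    invWishartUnnorm δ D Set.univ = 1 := by
  have hk : ∀ M : Matrix ι ι ℝ, invWishartKernel δ D M = 1 := fun M => by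
    have hM : M.PosDef := by
      rw [Subsingleton.elim M 1]
      exact Matrix.PosDef.one
    rw [invWishartKernel, Set.indicator_of_mem (by exact hM)]
    simp [Matrix.trace]
  rw [← lintegral_one, lintegral_invWishartUnnorm _ _ measurable_const]
  -- There are no free entries, so Lebesgue measure is a unit point mass.
  simp [hk, volume_pi]

end Reindex

/-! ### Coercivity of positive definite forms -/

section QuadraticForm

variable {ι : Type*} [Fintype ι]

/-- A positive definite quadratic form dominates a multiple of the squared norm. -/
theorem exists_mul_norm_sq_le_of_posDef {D : Matrix ι ι ℝ} (hD : D.PosDef) :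
    ∃ m > 0, ∀ w : ι → ℝ, m * ‖w‖ ^ 2 ≤ w ⬝ᵥ D *ᵥ w := by
  have hpos : ∀ w : ι → ℝ, w ≠ 0 → 0 < w ⬝ᵥ D *ᵥ w := fun w hw => by
    simpa using hD.dotProduct_mulVec_pos hw
  have hcont : Continuous fun w : ι → ℝ => w ⬝ᵥ D *ᵥ w := by fun_prop
  -- The constant is the minimum of the form on the compact unit sphere; an empty sphere forces the
  -- space to be trivial.
  rcases (Metric.sphere (0 : ι → ℝ) 1).eq_empty_or_nonempty with h | h
  · refine ⟨1, one_pos, fun w => ?_⟩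
    have hw : w = 0 := by
      by_contra hw
      have : ‖w‖⁻¹ • w ∈ Metric.sphere (0 : ι → ℝ) 1 := by
        simp [norm_smul, norm_ne_zero_iff.2 hw]
      simp [h] at this
    simp [hw]
  · obtain ⟨u, hu, hmin⟩ := (isCompact_sphere (0 : ι → ℝ) 1).exists_isMinOn h hcont.continuousOn
    refine ⟨u ⬝ᵥ D *ᵥ u, hpos u fun h0 => by simp [h0] at hu, fun w => ?_⟩
    by_cases hw : w = 0
    · simp [hw]
    have hn : 0 < ‖w‖ := norm_pos_iff.2 hw
    have hs : ‖w‖⁻¹ • w ∈ Metric.sphere (0 : ι → ℝ) 1 := by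
      simp [norm_smul, hn.ne']
    have := hmin hs
    simp only [Set.mem_ofPred_eq, Matrix.mulVec_smul, smul_dotProduct, dotProduct_smul,
      smul_eq_mul] at this
    calc u ⬝ᵥ D *ᵥ u * ‖w‖ ^ 2 ≤ ‖w‖⁻¹ * (‖w‖⁻¹ * (w ⬝ᵥ D *ᵥ w)) * ‖w‖ ^ 2 := by gcongr
      _ = w ⬝ᵥ D *ᵥ w := by field_simp

end QuadraticForm

/-! ### A separable bound for the inverse gamma density -/

section ScalarBound

/-- This is the $a$-th power of $1 + u \le a(1 + u/a) \le a e^{u/a}$. -/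
theorem one_add_rpow_le_mul_exp {a u : ℝ} (ha : 1 ≤ a) (hu : 0 ≤ u) :
    (1 + u) ^ a ≤ a ^ a * Real.exp u := by
  have ha0 : 0 < a := by linarith
  have h1 : 1 + u ≤ a * Real.exp (u / a) := by
    have := Real.add_one_le_exp (u / a)
    calc 1 + u ≤ a * (u / a + 1) := by rw [mul_add, mul_div_cancel₀ _ ha0.ne']; linarith
      _ ≤ a * Real.exp (u / a) := by gcongr
  calc (1 + u) ^ a ≤ (a * Real.exp (u / a)) ^ a := by gcongr
    _ = a ^ a * Real.exp u := by
      rw [Real.mul_rpow ha0.le (Real.exp_pos _).le, ← Real.exp_mul, div_mul_cancel₀ _ ha0.ne']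

/-- An inverse gamma density with scale `s` is dominated by a product of powers of the argument
and of any lower bound for the scale. -/
theorem rpow_mul_exp_neg_div_le {p r m l s t : ℝ} (hp : 1 ≤ p) (hr : 0 ≤ r) (hm : 0 < m)
    (hm1 : m ≤ 1) (hl : 0 < l) (ht : 0 ≤ t) (hs : m * (1 + t) ≤ s) :
    l ^ (-(p + r)) * Real.exp (-(s / l)) ≤
      (p + r) ^ (p + r) * m ^ (-(p + r)) * ((1 + l) ^ (-p) * (1 + t) ^ (-r)) := by
  have ha0 : 0 < p + r := by linarith
  have hs0 : 0 < s := lt_of_lt_of_le (by positivity) hs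
  have hu : 0 ≤ s / l := by positivity
  have h1 := one_add_rpow_le_mul_exp (a := p + r) (by linarith) hu
  have h2 : l ^ (-(p + r)) * Real.exp (-(s / l)) ≤
      (p + r) ^ (p + r) * (l + s) ^ (-(p + r)) := by
    -- The exponential is traded for the power $(1 + s/l)^{-(p+r)}$, which cancels the singularity
    -- at $l = 0$ and leaves $(l+s)^{-(p+r)}$.
    have hls : l + s = l * (1 + s / l) := by field_simp
    rw [hls, Real.mul_rpow hl.le (by positivity), Real.exp_neg,
      Real.rpow_neg (by positivity : 0 ≤ 1 + s / l), mul_left_comm]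
    gcongr
    rw [← div_eq_mul_inv, le_div_iff₀ (by positivity), inv_mul_le_iff₀ (Real.exp_pos _)]
    linarith
  have h3 : (l + s) ^ (-(p + r)) ≤ m ^ (-(p + r)) * ((1 + l) ^ (-p) * (1 + t) ^ (-r)) := by
    -- Splitting the exponent separates the variables: $l + s$ dominates both $m(1+l)$, using $m \le
    -- 1$, and $m(1+t)$.
    have e1 : (l + s) ^ (-p) ≤ (m * (1 + l)) ^ (-p) := by
      refine Real.rpow_le_rpow_of_nonpos (by positivity) ?_ (by linarith)
      nlinarith [mul_nonneg hm.le ht]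
    have e2 : (l + s) ^ (-r) ≤ (m * (1 + t)) ^ (-r) :=
      Real.rpow_le_rpow_of_nonpos (by positivity) (by linarith) (by linarith)
    rw [Real.mul_rpow hm.le (by positivity)] at e1 e2
    rw [neg_add, Real.rpow_add (by positivity), Real.rpow_add hm]
    calc _ ≤ (m ^ (-p) * (1 + l) ^ (-p)) * (m ^ (-r) * (1 + t) ^ (-r)) := by gcongr
      _ = _ := by ring
  calc _ ≤ _ := h2
    _ ≤ (p + r) ^ (p + r) * (m ^ (-(p + r)) * ((1 + l) ^ (-p) * (1 + t) ^ (-r))) := by gcongr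
    _ = _ := by ring

end ScalarBound

/-! ### The residual mass when one index is split off -/

section SingleResidual

variable {ι : Type*} [Fintype ι]

/-- The scale of a one-dimensional residual given the regression vector. -/
def scalarScale (D : Matrix (ι ⊕ Unit) (ι ⊕ Unit) ℝ) (b : Unit × ι → ℝ) : ℝ :=
  residualScale D (rectMat b) () ()

theorem scalarScale_eq (D : Matrix (ι ⊕ Unit) (ι ⊕ Unit) ℝ) (b : Unit × ι → ℝ) :
    scalarScale D b =
      (Sum.elim (fun i => b ((), i)) fun _ => -1) ⬝ᵥ
        D *ᵥ (Sum.elim (fun i => b ((), i)) fun _ => -1) := by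
  have hw : (Matrix.fromCols (rectMat b) (-1) : Matrix Unit (ι ⊕ Unit) ℝ) () =
      Sum.elim (fun i => b ((), i)) fun _ => -1 := by
    ext (i | k) <;> simp [rectMat]
  rw [scalarScale, residualScale, Matrix.mul_assoc, ← hw]
  rfl

theorem posDef_unit_iff (L : Matrix Unit Unit ℝ) : L.PosDef ↔ 0 < L () () := by
  have hL : L = Matrix.diagonal fun _ => L () () := by ext; simp
  rw [hL, Matrix.posDef_diagonal_iff]
  simp

theorem invWishartKernel_unit (δ : ℝ) (Q L : Matrix Unit Unit ℝ) :
    invWishartKernel δ Q L = (Set.Ioi (0 : ℝ)).indicator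
      (fun l => ENNReal.ofReal (l ^ (-(δ + 2) / 2) * Real.exp (-(Q () () / 2 / l)))) (L () ()) := by
  have hmem : L ∈ {Sig : Matrix Unit Unit ℝ | Sig.PosDef} ↔ L () () ∈ Set.Ioi (0 : ℝ) :=
    posDef_unit_iff L
  have htr : -(Q * L⁻¹).trace / 2 = -(Q () () / 2 / L () ()) := by
    simp [Matrix.trace, Matrix.mul_apply, Matrix.inv_subsingleton, Ring.inverse_eq_inv']
    ring
  simp only [invWishartKernel, Set.indicator, hmem, htr, Matrix.det_unique, Fintype.card_unit]
  simp

theorem residualMass_unit (δ : ℝ) (D : Matrix (ι ⊕ Unit) (ι ⊕ Unit) ℝ) :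
    residualMass δ D = ∫⁻ b : Unit × ι → ℝ, ∫⁻ l in Set.Ioi (0 : ℝ),
      ENNReal.ofReal (l ^ (-(δ + 2 * Fintype.card ι + 2) / 2) *
        Real.exp (-(scalarScale D b / 2 / l))) := by
  rw [residualMass]
  refine lintegral_congr fun b => ?_
  simp only [invWishartKernel_unit]
  rw [← lintegral_indicator measurableSet_Ioi]
  exact (volume_preserving_funUnique (Sym2 Unit) ℝ).lintegral_comp_emb
    (MeasurableEquiv.measurableEmbedding _) _

theorem measurable_scalarScale (D : Matrix (ι ⊕ Unit) (ι ⊕ Unit) ℝ) :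
    Measurable (scalarScale D) := by
  refine Continuous.measurable ?_
  have hw : Continuous fun b : Unit × ι → ℝ =>
      (Sum.elim (fun i => b ((), i)) fun _ => -1 : ι ⊕ Unit → ℝ) := by
    refine continuous_pi ?_
    rintro (i | k)
    · exact continuous_apply _
    · exact continuous_const
  simp only [funext (scalarScale_eq D)]
  fun_prop

theorem exists_mul_one_add_norm_sq_le_scalarScale {D : Matrix (ι ⊕ Unit) (ι ⊕ Unit) ℝ}
    (hD : D.PosDef) :
    ∃ m > 0, m ≤ 1 ∧ ∀ b : Unit × ι → ℝ, m * (1 + ‖b‖ ^ 2) ≤ scalarScale D b / 2 := by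
  obtain ⟨m, hm, h⟩ := exists_mul_norm_sq_le_of_posDef hD
  refine ⟨min (m / 4) 1, by positivity, min_le_right _ _, fun b => ?_⟩
  -- The fixed last coordinate $-1$ keeps $w$ away from zero, so $\|w\|$ dominates both $1$ and
  -- $\|b\|$.
  set w : ι ⊕ Unit → ℝ := Sum.elim (fun i => b ((), i)) fun _ => -1 with hw
  have h1 : 1 ≤ ‖w‖ := by
    simpa [hw] using norm_le_pi_norm w (Sum.inr ())
  have h2 : ‖b‖ ≤ ‖w‖ := by
    refine (pi_norm_le_iff_of_nonneg (norm_nonneg _)).2 ?_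
    rintro ⟨⟨⟩, i⟩
    exact norm_le_pi_norm w (Sum.inl i)
  have h3 : 1 + ‖b‖ ^ 2 ≤ 2 * ‖w‖ ^ 2 := by
    nlinarith [norm_nonneg b]
  have h4 := h w
  rw [scalarScale_eq]
  calc min (m / 4) 1 * (1 + ‖b‖ ^ 2) ≤ m / 4 * (2 * ‖w‖ ^ 2) := by
        gcongr
        exact min_le_left _ _
    _ = m * ‖w‖ ^ 2 / 2 := by ring
    _ ≤ _ := by gcongr

/-- The integrand is strictly positive on the half-line, which has positive Lebesgue measure. -/
theorem residualMass_unit_ne_zero (δ : ℝ) (D : Matrix (ι ⊕ Unit) (ι ⊕ Unit) ℝ) :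
    residualMass δ D ≠ 0 := by
  rw [residualMass_unit]
  have hm : Measurable fun z : (Unit × ι → ℝ) × ℝ =>
      ENNReal.ofReal (z.2 ^ (-(δ + 2 * Fintype.card ι + 2) / 2) *
        Real.exp (-(scalarScale D z.1 / 2 / z.2))) :=
    ((measurable_snd.pow_const _).mul ((((measurable_scalarScale D).comp
      measurable_fst).div_const 2).div measurable_snd).neg.exp).ennreal_ofReal
  intro h
  rw [lintegral_eq_zero_iff hm.lintegral_prod_right'] at h
  obtain ⟨b, hb⟩ := h.exists
  have hmb : Measurable fun l : ℝ => ENNReal.ofReal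
      (l ^ (-(δ + 2 * Fintype.card ι + 2) / 2) * Real.exp (-(scalarScale D b / 2 / l))) :=
    hm.comp measurable_prodMk_left
  have hb' := (setLIntegral_eq_zero_iff measurableSet_Ioi hmb).1 hb
  have hne : ∀ᵐ l : ℝ, l ∉ Set.Ioi (0 : ℝ) := by
    filter_upwards [hb'] with l hl hl0
    have hl' : 0 < l := hl0
    have := hl hl0
    simp only [ENNReal.ofReal_eq_zero] at this
    exact absurd this (not_le.2 (by positivity))
  have := measure_eq_zero_iff_ae_notMem.2 hne
  simp at this

theorem residualMass_unit_ne_top {δ : ℝ} (hδ : 0 < δ) {D : Matrix (ι ⊕ Unit) (ι ⊕ Unit) ℝ}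
    (hD : D.PosDef) : residualMass δ D ≠ ∞ := by
  obtain ⟨m, hm, hm1, h⟩ := exists_mul_one_add_norm_sq_le_scalarScale hD
  -- The total exponent is $1 + \mathrm{card}\,\iota + \delta/2$. The surplus $\delta/2$ is shared
  -- so that both factors are integrable: $p > 1$ on the line, and $2r > \mathrm{card}\,\iota$ for
  -- the regression vector, even when $\iota$ is empty.
  set p : ℝ := 1 + δ / 4 with hp
  set r : ℝ := Fintype.card ι + δ / 4 with hr
  have hr0 : 0 ≤ r := by positivity
  have hp1 : 1 ≤ p := by linarith
  have hpr : -(δ + 2 * Fintype.card ι + 2) / 2 = -(p + r) := by rw [hp, hr]; ring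
  set C : ℝ := (p + r) ^ (p + r) * m ^ (-(p + r)) with hC
  have hC0 : 0 ≤ C := by positivity
  have hl : ∫⁻ l : ℝ, ENNReal.ofReal ((1 + ‖l‖) ^ (-p)) < ∞ :=
    finite_integral_one_add_norm (by simp [hp, hδ])
  have hb : ∫⁻ b : Unit × ι → ℝ, ENNReal.ofReal ((1 + ‖b‖ ^ 2) ^ (-r)) < ∞ := by
    have := (integrable_rpow_neg_one_add_norm_sq (E := Unit × ι → ℝ) (μ := volume) (r := 2 * r)
      (by simp [hr]; linarith [(Nat.cast_nonneg (Fintype.card ι) : (0 : ℝ) ≤ _)])).lintegral_lt_top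
    have e : -(2 * r) / 2 = -r := by ring
    rwa [e] at this
  rw [residualMass_unit, hpr]
  refine ne_top_of_le_ne_top (b := ENNReal.ofReal C *
    ((∫⁻ l : ℝ, ENNReal.ofReal ((1 + ‖l‖) ^ (-p))) *
      ∫⁻ b : Unit × ι → ℝ, ENNReal.ofReal ((1 + ‖b‖ ^ 2) ^ (-r))))
    (ENNReal.mul_ne_top ENNReal.ofReal_ne_top (ENNReal.mul_ne_top hl.ne hb.ne)) ?_
  rw [← lintegral_const_mul' _ _ hl.ne, ← lintegral_const_mul' _ _ ENNReal.ofReal_ne_top]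
  refine lintegral_mono fun b => ?_
  rw [← lintegral_mul_const' _ _ ENNReal.ofReal_ne_top,
    ← lintegral_const_mul' _ _ ENNReal.ofReal_ne_top]
  refine (setLIntegral_mono' measurableSet_Ioi fun l hl => ?_).trans
    (setLIntegral_le_lintegral (Set.Ioi (0 : ℝ)) _)
  have hl0 : 0 < l := hl
  rw [← ENNReal.ofReal_mul (by positivity), ← ENNReal.ofReal_mul hC0, Real.norm_of_nonneg hl0.le]
  exact ENNReal.ofReal_le_ofReal
    (rpow_mul_exp_neg_div_le hp1 hr0 hm hm1 hl0 (by positivity) (h b))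

end SingleResidual

/-! ### Normalisability and diagonal blocks of the inverse Wishart law -/

section TotalMass

theorem invWishartUnnorm_univ_sum {ι κ : Type*} [Fintype ι] [DecidableEq ι] [Fintype κ]
    [DecidableEq κ] (δ : ℝ) (D : Matrix (ι ⊕ κ) (ι ⊕ κ) ℝ) :
    invWishartUnnorm δ D Set.univ =
      residualMass δ D * invWishartUnnorm δ D.toBlocks₁₁ Set.univ := by
  rw [← smul_eq_mul, ← Measure.smul_apply, ← map_toBlocks₁₁_invWishartUnnorm,
    Measure.map_apply measurable_toBlocks₁₁ .univ, Set.preimage_univ]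

/-- Induction on the index type: each new index multiplies the mass by a scalar residual mass,
starting from mass one for the empty matrix. -/
theorem invWishartUnnorm_univ_ne {δ : ℝ} (hδ : 0 < δ) (ι : Type*) [Fintype ι] :
    ∀ [DecidableEq ι] (D : Matrix ι ι ℝ), D.PosDef →
      invWishartUnnorm δ D Set.univ ≠ 0 ∧ invWishartUnnorm δ D Set.univ ≠ ∞ := by
  refine Fintype.induction_empty_option (P := fun ι _ => ∀ [DecidableEq ι] (D : Matrix ι ι ℝ),
    D.PosDef → invWishartUnnorm δ D Set.univ ≠ 0 ∧ invWishartUnnorm δ D Set.univ ≠ ∞) ?_ ?_ ?_ ι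
  · intro α β _ e ih _ D hD
    classical
    let _ := Fintype.ofEquiv β e.symm
    have := ih (D.submatrix e e) ((posDef_submatrix_equiv_iff e D).2 hD)
    rwa [invWishartUnnorm_submatrix_univ] at this
  · intro _ D _
    simp [invWishartUnnorm_univ_of_isEmpty]
  · intro α _ ih _ D hD
    classical
    have e : α ⊕ Unit ≃ Option α := (Equiv.optionEquivSumPUnit α).symm
    have hD' := (posDef_submatrix_equiv_iff e D).2 hD
    have h := ih _ (posDef_toBlocks₁₁ hD')
    rw [← invWishartUnnorm_submatrix_univ e, invWishartUnnorm_univ_sum]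
    exact ⟨mul_ne_zero (residualMass_unit_ne_zero _ _) h.1,
      ENNReal.mul_ne_top (residualMass_unit_ne_top hδ hD') h.2⟩

variable {ι κ : Type*} [Fintype ι] [DecidableEq ι] [Fintype κ] [DecidableEq κ]

theorem isProbabilityMeasure_invWishart {δ : ℝ} (hδ : 0 < δ) {D : Matrix ι ι ℝ}
    (hD : D.PosDef) : IsProbabilityMeasure (invWishart δ D) := by
  have h := invWishartUnnorm_univ_ne hδ ι D hD
  exact ⟨by rw [invWishart, Measure.smul_apply, smul_eq_mul, ENNReal.inv_mul_cancel h.1 h.2]⟩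

/-- The upper left block of an inverse Wishart matrix is inverse Wishart. -/
theorem map_toBlocks₁₁_invWishart {δ : ℝ} (hδ : 0 < δ) {D : Matrix (ι ⊕ κ) (ι ⊕ κ) ℝ}
    (hD : D.PosDef) :
    (invWishart δ D).map (fun M => M.toBlocks₁₁) = invWishart δ D.toBlocks₁₁ := by
  have h := invWishartUnnorm_univ_ne hδ _ D hD
  rw [invWishartUnnorm_univ_sum] at h
  -- For a residual block of any size, `residualMass` is finite and nonzero because it is a factor
  -- of a finite nonzero total mass.
  have h0 : residualMass δ D ≠ 0 := left_ne_zero_of_mul h.1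
  have h1 : residualMass δ D ≠ ∞ := fun ht => h.2 (by
    rw [ht, ENNReal.top_mul (right_ne_zero_of_mul h.1)])
  rw [invWishart, invWishart, Measure.map_smul, map_toBlocks₁₁_invWishartUnnorm,
    invWishartUnnorm_univ_sum, smul_smul, ENNReal.mul_inv (.inl h0) (.inl h1), mul_right_comm,
    ENNReal.inv_mul_cancel h0 h1, one_mul]

theorem map_submatrix_invWishart (e : ι ≃ κ) (δ : ℝ) (D : Matrix κ κ ℝ) :
    (invWishart δ D).map (fun M => M.submatrix e e) = invWishart δ (D.submatrix e e) := by
  rw [invWishart, invWishart, Measure.map_smul, map_submatrix_invWishartUnnorm,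
    invWishartUnnorm_submatrix_univ]

/-- The lower right block of an inverse Wishart matrix is inverse Wishart. -/
theorem map_toBlocks₂₂_invWishart {δ : ℝ} (hδ : 0 < δ) {D : Matrix (ι ⊕ κ) (ι ⊕ κ) ℝ}
    (hD : D.PosDef) :
    (invWishart δ D).map (fun M => M.toBlocks₂₂) = invWishart δ D.toBlocks₂₂ := by
  -- Swapping the two summands turns the lower right block into the upper left one.
  have h := map_toBlocks₁₁_invWishart hδ ((posDef_submatrix_equiv_iff (Equiv.sumComm κ ι) D).2 hD)
  rw [← map_submatrix_invWishart, Measure.map_map measurable_toBlocks₁₁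
    (measurable_submatrix _)] at h
  exact h

end TotalMass

/-! ### Markov processes with an invariant initial law -/

section Markov

variable {Ω E : Type*} [MeasurableSpace Ω] [MeasurableSpace E] {P : Measure Ω}
  [IsProbabilityMeasure P] {X : ℕ → Ω → E} {κ : Kernel E E} [IsMarkovKernel κ] {μ : Measure E}

/-- The kernel on histories up to time `t` that applies `κ` to the present state. -/
def presentKernel (κ : Kernel E E) (t : ℕ) : Kernel (Finset.Iic t → E) E :=
  κ.comap (fun x => x ⟨t, Finset.mem_Iic.2 le_rfl⟩) (measurable_pi_apply _)

instance (t : ℕ) : IsMarkovKernel (presentKernel κ t) := by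
  unfold presentKernel
  infer_instance

/-- The kernel reads only the present state $X_{m+h}$, which lies in the window, so forgetting the
states before time $h$ leaves the conditional law unchanged. -/
theorem hasCondDistrib_window
    (hX : ∀ t, HasCondDistrib (X (t + 1)) (fun ω (i : Finset.Iic t) => X i ω)
      (presentKernel κ t) P) (h m : ℕ) :
    HasCondDistrib (X (m + 1 + h)) (fun ω (i : Finset.Iic m) => X (i + h) ω)
      (presentKernel κ m) P := by
  have hm : ∀ i : Finset.Iic m, (i : ℕ) + h ∈ Finset.Iic (m + h) := fun i =>
    Finset.mem_Iic.2 (Nat.add_le_add_right (Finset.mem_Iic.1 i.2) h)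
  have hf : Measurable fun (x : Finset.Iic (m + h) → E) (i : Finset.Iic m) => x ⟨i + h, hm i⟩ :=
    measurable_pi_lambda _ fun i => measurable_pi_apply _
  rw [Nat.add_right_comm]
  exact HasCondDistrib.comp_right (κ := presentKernel κ m) (hf := hf) (hX (m + h))

theorem hasCondDistrib_succ
    (hX : ∀ t, HasCondDistrib (X (t + 1)) (fun ω (i : Finset.Iic t) => X i ω)
      (presentKernel κ t) P) (t : ℕ) :
    HasCondDistrib (X (t + 1)) (X t) κ P :=
  HasCondDistrib.comp_right (hf := measurable_pi_apply _) (hX t)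

theorem hasLaw_of_invariant (hμ : (μ ⊗ₘ κ).snd = μ) (h0 : HasLaw (X 0) μ P)
    (hX : ∀ t, HasCondDistrib (X (t + 1)) (fun ω (i : Finset.Iic t) => X i ω)
      (presentKernel κ t) P) (t : ℕ) : HasLaw (X t) μ P := by
  induction t with
  | zero => exact h0
  | succ t ih =>
    have h := ih.prodMk_of_hasCondDistrib (hasCondDistrib_succ hX t)
    refine ⟨(hasCondDistrib_succ hX t).aemeasurable_snd, ?_⟩
    rw [← Measure.snd_map_prodMk₀ ih.aemeasurable, h.map_eq, hμ]

/-- Extends a finite trajectory by one state. -/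
def appendState (m : ℕ) (z : (Finset.Iic m → E) × E) (i : Finset.Iic (m + 1)) : E :=
  if h : (i : ℕ) ≤ m then z.1 ⟨i, Finset.mem_Iic.2 h⟩ else z.2

theorem measurable_appendState (m : ℕ) : Measurable (appendState (E := E) m) := by
  refine measurable_pi_lambda _ fun i => ?_
  by_cases h : (i : ℕ) ≤ m
  · simp only [appendState, h, dif_pos]
    exact (measurable_pi_apply _).comp measurable_fst
  · simp only [appendState, h, dif_neg, not_false_eq_true]
    exact measurable_snd

/-- A window is extended by one state through a kernel that does not depend on the shift $h$; only
the one-state window needs invariance of $\mu$. -/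
theorem map_window_eq (hμ : (μ ⊗ₘ κ).snd = μ) (h0 : HasLaw (X 0) μ P)
    (hX : ∀ t, HasCondDistrib (X (t + 1)) (fun ω (i : Finset.Iic t) => X i ω)
      (presentKernel κ t) P) (h m : ℕ) :
    P.map (fun ω (i : Finset.Iic m) => X (i + h) ω) =
      P.map (fun ω (i : Finset.Iic m) => X i ω) := by
  induction m with
  | zero =>
    have hc : Measurable fun (x : E) (_ : Finset.Iic 0) => x :=
      measurable_pi_lambda _ fun _ => measurable_id
    have key : ∀ k, P.map (fun ω (i : Finset.Iic 0) => X ((i : ℕ) + k) ω) =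
        μ.map fun x _ => x := fun k => by
      have hk := hasLaw_of_invariant hμ h0 hX k
      rw [← hk.map_eq, AEMeasurable.map_map_of_aemeasurable hc.aemeasurable hk.aemeasurable]
      congr 1
      ext ω i
      have hi : (i : ℕ) = 0 := Nat.le_zero.1 (Finset.mem_Iic.1 i.2)
      simp [hi]
    exact (key h).trans (key 0).symm
  | succ m ih =>
    have key : ∀ k, P.map (fun ω (i : Finset.Iic (m + 1)) => X ((i : ℕ) + k) ω) =
        (P.map (fun ω (i : Finset.Iic m) => X ((i : ℕ) + k) ω) ⊗ₘ presentKernel κ m).map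
          (appendState m) := fun k => by
      have hw := hasCondDistrib_window hX k m
      rw [← hw.map_eq, AEMeasurable.map_map_of_aemeasurable
        (measurable_appendState m).aemeasurable hw.aemeasurable]
      congr 1
      ext ω i
      by_cases hi : (i : ℕ) ≤ m
      · simp [appendState, hi]
      · have hi' : (i : ℕ) = m + 1 := by
          have := Finset.mem_Iic.1 i.2
          omega
        simp [appendState, hi']
    rw [key h, ih]
    exact (key 0).symm

/-- A Markov process whose initial law is invariant under its transition kernel is strictly
stationary. -/
theorem strictlyStationary_of_invariant (hμ : (μ ⊗ₘ κ).snd = μ) (h0 : HasLaw (X 0) μ P)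
    (hX : ∀ t, HasCondDistrib (X (t + 1)) (fun ω (i : Finset.Iic t) => X i ω)
      (presentKernel κ t) P) : StrictlyStationary P X := by
  intro h m t
  -- Arbitrary times, possibly unordered or repeated, are coordinates of the full window up to their
  -- maximum.
  set N := Finset.univ.sup t with hN
  have ht : ∀ j, t j ∈ Finset.Iic N := fun j =>
    Finset.mem_Iic.2 (Finset.le_sup (Finset.mem_univ j))
  have hp : Measurable fun (w : Finset.Iic N → E) (j : Fin m) => w ⟨t j, ht j⟩ :=
    measurable_pi_lambda _ fun j => measurable_pi_apply _
  have key : ∀ k, P.map (fun ω j => X (t j + k) ω) =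
      (P.map fun ω (i : Finset.Iic N) => X ((i : ℕ) + k) ω).map
        fun (w : Finset.Iic N → E) (j : Fin m) => w ⟨t j, ht j⟩ := fun k => by
    rw [AEMeasurable.map_map_of_aemeasurable hp.aemeasurable (aemeasurable_pi_lambda _ fun i =>
      (hasLaw_of_invariant hμ h0 hX _).aemeasurable)]
    rfl
  rw [key h, map_window_eq hμ h0 hX]
  exact (key 0).symm

/-- Restricted to times up to $0$, the trajectory kernel is the identity, so only the initial law
remains. -/
theorem map_eval_zero_trajMeasure [IsProbabilityMeasure μ]
    (η : (n : ℕ) → Kernel (Finset.Iic n → E) E) [∀ n, IsMarkovKernel (η n)] :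
    (Kernel.trajMeasure (X := fun _ => E) μ η).map (fun ω => ω 0) = μ := by
  have hr : Measurable (Preorder.frestrictLe (π := fun _ : ℕ => E) 0) :=
    Preorder.measurable_frestrictLe 0
  have he : Measurable (MeasurableEquiv.piUnique fun _ : Finset.Iic 0 => E) :=
    MeasurableEquiv.measurable _
  have hs : Measurable (MeasurableEquiv.piUnique fun _ : Finset.Iic 0 => E).symm :=
    MeasurableEquiv.measurable _
  have h1 : (Kernel.trajMeasure (X := fun _ => E) μ η).map (Preorder.frestrictLe 0) =
      μ.map (MeasurableEquiv.piUnique fun _ : Finset.Iic 0 => E).symm := by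
    rw [Kernel.trajMeasure, Measure.map_comp _ _ hr, Kernel.traj_map_frestrictLe,
      Kernel.partialTraj_self, Measure.id_comp]
  calc (Kernel.trajMeasure (X := fun _ => E) μ η).map (fun ω => ω 0)
      = ((Kernel.trajMeasure (X := fun _ => E) μ η).map (Preorder.frestrictLe 0)).map
          (MeasurableEquiv.piUnique fun _ : Finset.Iic 0 => E) := (Measure.map_map he hr).symm
    _ = μ := by
      rw [h1, Measure.map_map he hs, MeasurableEquiv.self_comp_symm, Measure.map_id]

/-- The Markov process with given initial law and transition kernel exists. -/
theorem exists_markov_process (μ : Measure E) [IsProbabilityMeasure μ] (κ : Kernel E E)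
    [IsMarkovKernel κ] :
    ∃ Q : Measure (ℕ → E), IsProbabilityMeasure Q ∧ HasLaw (fun ω => ω 0) μ Q ∧
      ∀ t, HasCondDistrib (fun ω => ω (t + 1)) (fun ω (i : Finset.Iic t) => ω i)
        (presentKernel κ t) Q := by
  refine ⟨Kernel.trajMeasure (X := fun _ => E) μ (presentKernel κ), inferInstance,
    ⟨(measurable_pi_apply 0).aemeasurable, map_eval_zero_trajMeasure _⟩, fun t => ⟨?_, ?_⟩⟩
  · exact Measurable.aemeasurable (by fun_prop)
  · exact Kernel.map_frestrictLe_trajMeasure_compProd_eq_map_trajMeasure.symm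

end Markov

/-! ### The IW-AR(1) scale matrix, its consecutive law and existence -/

section Autoregression

variable {q : ℕ} {n : ℝ} {S F : Matrix (Fin q) (Fin q) ℝ}

theorem posDef_smul_blockScale_iff (hn : 0 < n) (S F : Matrix (Fin q) (Fin q) ℝ) :
    (n • blockScale S F).PosDef ↔ S.PosDef ∧ (S - F * S * Fᵀ).PosDef := by
  have hsm : (n • blockScale S F).PosDef ↔ (blockScale S F).PosDef := by
    refine ⟨fun h => ?_, fun h => h.smul hn⟩
    simpa [smul_smul, inv_mul_cancel₀ hn.ne'] using h.smul (inv_pos.2 hn)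
  have key : S.PosDef → ((blockScale S F).PosDef ↔ (S - F * S * Fᵀ).PosDef) := fun hS => by
    -- Symmetry of $S$ puts $M$ in the form required by the Schur criterion, with complement $S -
    -- FS\,S^{-1}SF' = V$.
    have hb : S * Fᵀ = (F * S)ᵀ := by
      rw [Matrix.transpose_mul, transpose_eq_of_posDef hS]
    rw [blockScale, hb, posDef_fromBlocks_iff _ _ hS, ← hb, Matrix.mul_nonsing_inv_cancel_right _ _
      hS.det_pos.ne'.isUnit, Matrix.mul_assoc]
  rw [hsm]
  constructor
  · intro h
    have hS : S.PosDef := by simpa [blockScale] using posDef_toBlocks₁₁ h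
    exact ⟨hS, (key hS).1 h⟩
  · exact fun h => (key h.1).2 h.2

theorem measurable_toBlocks₂₂ {ι κ : Type*} :
    Measurable fun M : Matrix (ι ⊕ κ) (ι ⊕ κ) ℝ => M.toBlocks₂₂ :=
  measurable_matrix fun _ _ => measurable_matrix_apply _ _

theorem fst_consecutiveLaw (hn : 0 < n) (hM : (n • blockScale S F).PosDef) :
    (consecutiveLaw n S F).fst = invWishart (n + 2) (n • S) := by
  rw [consecutiveLaw, Measure.fst_map_prodMk measurable_toBlocks₂₂,
    map_toBlocks₁₁_invWishart (by linarith) hM]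
  rfl

theorem snd_consecutiveLaw (hn : 0 < n) (hM : (n • blockScale S F).PosDef) :
    (consecutiveLaw n S F).snd = invWishart (n + 2) (n • S) := by
  rw [consecutiveLaw, Measure.snd_map_prodMk measurable_toBlocks₁₁,
    map_toBlocks₂₂_invWishart (by linarith) hM]
  rfl

theorem isProbabilityMeasure_consecutiveLaw (hn : 0 < n) (hM : (n • blockScale S F).PosDef) :
    IsProbabilityMeasure (consecutiveLaw n S F) := by
  have := isProbabilityMeasure_invWishart (δ := n + 2) (by linarith) hM
  exact Measure.isProbabilityMeasure_map
    (measurable_toBlocks₁₁.prodMk measurable_toBlocks₂₂).aemeasurable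

theorem exists_isIWAR1 (hn : 0 < n) (hM : (n • blockScale S F).PosDef) :
    ∃ P : Measure (ℕ → Matrix (Fin q) (Fin q) ℝ), IsProbabilityMeasure P ∧
      IsIWAR1 n S F P (fun t ω => ω t) := by
  have := isProbabilityMeasure_consecutiveLaw hn hM
  obtain ⟨P, hP, h0, hX⟩ :=
    exists_markov_process (consecutiveLaw n S F).fst (consecutiveLaw n S F).condKernel
  exact ⟨P, hP, _, inferInstance, (consecutiveLaw n S F).disintegrate _, h0, hX⟩

end Autoregression

end IWAR

end

theorem theorem1 {q : ℕ} (n : ℝ) (hn : 0 < n) (S F : Matrix (Fin q) (Fin q) ℝ) :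
    -- the scale matrix is valid exactly when `S` and `V = S - F S F'` are positive definite
    ((n • IWAR.blockScale S F).PosDef ↔ S.PosDef ∧ (S - F * S * Fᵀ).PosDef) ∧
    (S.PosDef → (S - F * S * Fᵀ).PosDef →
      -- the inverse Wishart laws are genuine probability laws
      IsProbabilityMeasure (IWAR.invWishart (n + 2) (n • IWAR.blockScale S F)) ∧
      IsProbabilityMeasure (IWAR.invWishart (n + 2) (n • S)) ∧
      -- the process exists
      (∃ P : Measure (ℕ → Matrix (Fin q) (Fin q) ℝ), IsProbabilityMeasure P ∧
        IWAR.IsIWAR1 n S F P (fun t ω => ω t)) ∧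
      -- it is strictly stationary, with the stated laws of consecutive pairs and margins
      ∀ {Ω : Type*} [MeasurableSpace Ω] (P : Measure Ω) [IsProbabilityMeasure P]
        (X : ℕ → Ω → Matrix (Fin q) (Fin q) ℝ), IWAR.IsIWAR1 n S F P X →
        IWAR.StrictlyStationary P X ∧
        (∀ t, HasLaw (fun ω => (X t ω, X (t + 1) ω)) (IWAR.consecutiveLaw n S F) P) ∧
        (∀ t, HasLaw (X t) (IWAR.invWishart (n + 2) (n • S)) P)) := by
  refine ⟨IWAR.posDef_smul_blockScale_iff hn S F, fun hS hV => ?_⟩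
  have hM := (IWAR.posDef_smul_blockScale_iff hn S F).2 ⟨hS, hV⟩
  have hδ : 0 < n + 2 := by linarith
  refine ⟨IWAR.isProbabilityMeasure_invWishart hδ hM,
    IWAR.isProbabilityMeasure_invWishart hδ (hS.smul hn), IWAR.exists_isIWAR1 hn hM, ?_⟩
  rintro Ω _ P _ X ⟨κ, hκ, hJ, h0, hX⟩
  have hfst := IWAR.fst_consecutiveLaw hn hM
  -- Equality of the two margins of $J$ is invariance of the initial law, for any version $\kappa$
  -- of the conditional distribution.
  have hinv : ((IWAR.consecutiveLaw n S F).fst ⊗ₘ κ).snd = (IWAR.consecutiveLaw n S F).fst := by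
    rw [hJ, hfst, IWAR.snd_consecutiveLaw hn hM]
  have hlaw := IWAR.hasLaw_of_invariant hinv h0 hX
  refine ⟨IWAR.strictlyStationary_of_invariant hinv h0 hX, fun t => ?_, fun t => hfst ▸ hlaw t⟩
  have h := (hlaw t).prodMk_of_hasCondDistrib (IWAR.hasCondDistrib_succ hX t)
  rwa [hJ] at h
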